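/- Let $K\ge 2$ and let $\sigma,B,c,H>0$. A $K$-armed bandit model is a family $\nu=(\nu_a)_{a\in[K]}$ of probability distributions on $\mathbb R$ with finite means $\mu_a=\mathbb E_{\nu_a}[X]$. Let $\mathcal M$ be the class of models such that, for every arm $a$, $\mu_a\in[0,B]$ and $\nu_a$ is $\sigma$-sub-Gaussian, i.e. $\mathbb P_{\nu_a}(X-\mu_a>t)\le\exp(-t^2/(2\sigma^2))$ for all $t>0$. The complexity of $\nu$ is $\mathcal H(\nu)=\sum_{k\ne b}(\mu_b-\mu_k)^{-2}$, where $b$ is an arm of largest mean ($\mathcal H(\nu)=\infty$ if the largest mean is attained twice), and $\mathcal M_H=\{\nu\in\mathcal M:\mathcal H(\nu)\le H\}$. A policy $\pi$ decides in each round, possibly at random and depending on the arms pulled and the rewards observed so far, either to pull an arm $A_t$, in which case it observes an independent sample of $\nu_{A_t}$, or to stop and recommend an arm $\hat I\in[K]$. Let $\tau\in\{0,1,2,\dots\}\cup\{\infty\}$ be the number of samples taken, and let $$R_1(\pi,\nu)=\mathbb P_{\nu,\pi}\bigl(\mu_{\hat I}\ne\max_a\mu_a\bigr)+c\,\mathbb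 E_{\nu,\pi}[\tau]\in[0,\infty].$$ Suppose that $HB^2\ge 4(K-1)$; if $K=2$, it is enough that $HB^2\ge 1$. Then, for every policy $\pi$, $$\sup_{\nu\in\mathcal M_H}R_1(\pi,\nu)\;\ge\;\begin{cases}\dfrac{\sigma^2cH}{4}\log\Bigl(\dfrac{e}{\sigma^2cH}\Bigr), & H\le(\sigma^2c)^{-1},\\[2mm] \dfrac14, & H>(\sigma^2c)^{-1}.\end{cases}$$ -/

import Mathlib

open MeasureTheory ProbabilityTheory
open scoped ENNReal

namespace BAI

/-- A decision of the learner: pull an arm, or stop and recommend an arm. -/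
inductive Decision (K : ℕ) : Type
  | pull (a : Fin K)
  | recommend (i : Fin K)

instance (K : ℕ) : MeasurableSpace (Decision K) := ⊤

/-- The record of a round: the decision taken and the reward observed. -/
abbrev Round (K : ℕ) : Type := Decision K × ℝ

/-- A (possibly randomized) policy: the law of the first decision, and the conditional law of
decision number `n + 1` given the records of rounds `0, …, n`. What the kernels do after a
recommendation has occurred is immaterial, since only the first recommendation is ever looked at. -/
structure Policy (K : ℕ) where
  first : ProbabilityMeasure (Decision K)
  next : (n : ℕ) → Kernel ((i : Finset.Iic n) → Round K) (Decision K)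
  markov : ∀ n, IsMarkovKernel (next n)

instance {K : ℕ} (π : Policy K) (n : ℕ) : IsMarkovKernel (π.next n) := π.markov n

/-- A bandit model with `K` arms: a probability distribution on `ℝ` for each arm. -/
abbrev Model (K : ℕ) : Type := Fin K → ProbabilityMeasure ℝ

/-- The mean reward of an arm. -/
noncomputable def mean {K : ℕ} (ν : Model K) (a : Fin K) : ℝ := ∫ x, x ∂(ν a : Measure ℝ)

/-- `σ`-sub-Gaussian distributions on `ℝ`. -/
def IsSubGaussian (σ : ℝ) (P : ProbabilityMeasure ℝ) : Prop :=
  Integrable (fun x : ℝ => x) (P : Measure ℝ) ∧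
    ∀ t : ℝ, 0 < t →
      (P : Measure ℝ) {x | t < x - ∫ y, y ∂(P : Measure ℝ)}
        ≤ ENNReal.ofReal (Real.exp (-(t ^ 2 / (2 * σ ^ 2))))

/-- `b` is an arm of largest mean. -/
def IsBest {K : ℕ} (ν : Model K) (b : Fin K) : Prop := ∀ a, mean ν a ≤ mean ν b

/-- The complexity `∑_{k ≠ b} (μ_b - μ_k)⁻²` with `b` a best arm, as an extended nonnegative
number (it is `∞` if the best arm is not unique). All best arms `b` give the same value, so the
infimum over them only serves to avoid choosing one. -/
noncomputable def complexity {K : ℕ} (ν : Model K) : ℝ≥0∞ :=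
  ⨅ (b : Fin K) (_ : IsBest ν b),
    ∑ k ∈ Finset.univ.erase b, ((ENNReal.ofReal (mean ν b - mean ν k))⁻¹) ^ 2

/-- The class of `K`-armed models with `σ`-sub-Gaussian rewards and means in `[0, B]`. -/
def models (K : ℕ) (σ B : ℝ) : Set (Model K) :=
  {ν | ∀ a, IsSubGaussian σ (ν a) ∧ mean ν a ∈ Set.Icc 0 B}

/-- The subclass of models of complexity at most `H`. -/
def modelsOfComplexity (K : ℕ) (σ B H : ℝ) : Set (Model K) :=
  {ν | ν ∈ models K σ B ∧ complexity ν ≤ ENNReal.ofReal H}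

/-- The law of the reward given the decision: a pull of arm `a` yields a sample of `ν a`; no
sample is drawn at a recommendation (the record is filled up with the value `0`). -/
noncomputable def rewardKernel {K : ℕ} (ν : Model K) : Kernel (Decision K) ℝ where
  toFun d := match d with
    | .pull a => (ν a : Measure ℝ)
    | .recommend _ => Measure.dirac 0
  measurable' := measurable_from_top

instance {K : ℕ} (ν : Model K) : IsMarkovKernel (rewardKernel ν) where
  isProbabilityMeasure d := by
    cases d with
    | pull a => exact inferInstanceAs (IsProbabilityMeasure (ν a : Measure ℝ))
    | recommend i => exact inferInstanceAs (IsProbabilityMeasure (Measure.dirac (0 : ℝ)))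

/-- The conditional law of the record of round `n + 1` given the records of rounds `0, …, n`. -/
noncomputable def stepKernel {K : ℕ} (π : Policy K) (ν : Model K) (n : ℕ) :
    Kernel ((i : Finset.Iic n) → Round K) (Round K) :=
  π.next n ⊗ₖ Kernel.prodMkLeft _ (rewardKernel ν)

instance {K : ℕ} (π : Policy K) (ν : Model K) (n : ℕ) : IsMarkovKernel (stepKernel π ν n) := by
  unfold stepKernel; infer_instance

/-- The law of the interaction of the policy `π` with the model `ν`, on sequences of records. -/
noncomputable def law {K : ℕ} (π : Policy K) (ν : Model K) : Measure (ℕ → Round K) :=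
  Kernel.trajMeasure (X := fun _ => Round K)
    ((π.first : Measure (Decision K)) ⊗ₘ rewardKernel ν) (stepKernel π ν)

/-- In the run `ω`, the learner stops in round `t` (not necessarily for the first time). -/
def StopsAt {K : ℕ} (ω : ℕ → Round K) (t : ℕ) : Prop := ∃ i, (ω t).1 = Decision.recommend i

/-- The total number of samples `τ`: the index of the first recommendation, and `∞` if there is none.
As rounds are numbered from `0`, exactly `τ` pulls precede the first recommendation. -/
noncomputable def stoppingTime {K : ℕ} (ω : ℕ → Round K) : ℕ∞ :=
  ⨅ (t : ℕ) (_ : StopsAt ω t), (t : ℕ∞)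

/-- The arm recommended upon termination is `i`. -/
def Recommends {K : ℕ} (ω : ℕ → Round K) (i : Fin K) : Prop :=
  ∃ t : ℕ, (ω t).1 = Decision.recommend i ∧ ∀ s < t, ¬ StopsAt ω s

/-- The risk `R₁(π, ν)`: the probability that the recommended arm is not of largest mean, plus
`c` times the expected number of samples. It is `∞` if the learner fails to stop with positive
probability. -/
noncomputable def risk₁ {K : ℕ} (c : ℝ) (π : Policy K) (ν : Model K) : ℝ≥0∞ :=
  law π ν {ω | ∃ i, Recommends ω i ∧ ¬ IsBest ν i}
    + ENNReal.ofReal c * ∫⁻ ω, (stoppingTime ω : ℝ≥0∞) ∂(law π ν)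

/-- The hardness `ℋ₁(H)` of the complexity level `H`. -/
noncomputable def hardness₁ (σ c H : ℝ) : ℝ :=
  if H ≤ (σ ^ 2 * c)⁻¹ then
    σ ^ 2 * c * H / 4 * Real.log (Real.exp 1 / (σ ^ 2 * c * H))
  else 1 / 4

end BAI

namespace BAI

variable {K : ℕ}

/-! This is a two-point argument. Take two Gaussian models of variance `σ ^ 2` that differ by
swapping the means `B` and `B - Δ` of two arms, all other means being `0`. No recommendation is
correct under both. Each pull has relative entropy at most `δ = Δ ^ 2 / (2 * σ ^ 2)`, so the
log-likelihood ratio `S` of the run up to its first recommendation satisfies `E₁ S ≥ -δ * E₁ τ` and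
`E₁ (exp S) = 1` (both proved for the run cut off at round `n`).

The error probabilities `p₁`, `p₂` satisfy `p₁ + p₂ ≥ E₁ (min 1 (exp S))` up to the probability of
not having stopped by round `n`, which vanishes in the limit (`IsLogRatio.lintegral_min_le`,
`tendsto_law_alive`). Instead of the Bretagnolle–Huber bound itself, its tangent with free parameter
`κ` is integrated (`exp_neg_mul_sub_le_min`). This gives `p₁ + p₂ ≥ exp (-κ) / 2 * (1 + κ - δ * E₁
τ)`, which is linear in `E₁ τ`. If `exp (-κ) * δ / 2 ≤ c`, the sampling cost `c * E₁ τ` compensates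
for the last term, and the two risks sum to at least `exp (-κ) * (1 + κ) / 2`
(`IsLogRatio.le_risk_add_risk`). The supremum is at least half of that. It remains to take `Δ ^ 2`
at most `4 / (3 * H)` within the complexity budget (`exists_gap`) and to choose `κ`
(`exists_exp_neg_mul_ge`). -/

instance : DiscreteMeasurableSpace (Decision K) := ⟨fun _ => trivial⟩

instance : Finite (Decision K) := by
  have h : Function.Injective
      (fun d : Decision K => (match d with | .pull a => Sum.inl a | .recommend i => Sum.inr i :
        Fin K ⊕ Fin K)) := by
    intro d d'
    cases d <;> cases d' <;> simp
  exact Finite.of_injective _ h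

instance (π : Policy K) (ν : Model K) : IsProbabilityMeasure (law π ν) := by
  unfold law; infer_instance

/-! ### Disintegration of the interaction, one round at a time. -/

/-- The conditional law of the decision of round `s` given the whole run; it depends only on the
rounds before `s`. -/
noncomputable def decisionKernel (π : Policy K) : ℕ → Kernel (ℕ → Round K) (Decision K)
  | 0 => Kernel.const _ (π.first : Measure (Decision K))
  | n + 1 => (π.next n).comap (Preorder.frestrictLe n) (by fun_prop)

instance (π : Policy K) (s : ℕ) : IsMarkovKernel (decisionKernel π s) := by
  cases s <;> (unfold decisionKernel; infer_instance)

/-- The run `ω` with all records from round `s` on replaced by `y₀`. -/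
def past (y₀ : Round K) (s : ℕ) (ω : ℕ → Round K) : ℕ → Round K :=
  fun i => if i < s then ω i else y₀

lemma past_zero (y₀ : Round K) (ω : ℕ → Round K) : past y₀ 0 ω = fun _ => y₀ := by
  funext i; simp [past]

lemma past_apply {y₀ : Round K} {s i : ℕ} (h : i < s) (ω : ℕ → Round K) :
    past y₀ s ω i = ω i := if_pos h

lemma past_succ (y₀ : Round K) (s : ℕ) (ω : ℕ → Round K) :
    past y₀ (s + 1) ω = Function.update (past y₀ s ω) s (ω s) := by
  funext i
  rcases lt_trichotomy i s with h | rfl | h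
  · simp [past, h, h.ne, Nat.lt_succ_of_lt h]
  · simp [past]
  · simp [past, h.ne', not_lt.2 h.le, not_lt.2 (Nat.succ_le_of_lt h)]

lemma decisionKernel_past (π : Policy K) (y₀ : Round K) (s : ℕ) (ω : ℕ → Round K) :
    decisionKernel π s (past y₀ s ω) = decisionKernel π s ω := by
  cases s with
  | zero => rfl
  | succ n =>
    have : Preorder.frestrictLe (π := fun _ => Round K) n (past y₀ (n + 1) ω)
        = Preorder.frestrictLe n ω := by
      funext i
      have := Finset.mem_Iic.1 i.2
      simp [past, Preorder.frestrictLe, Nat.lt_succ_of_le this]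
    simp only [decisionKernel, Kernel.comap_apply]
    rw [this]

lemma map_eval_zero_law (π : Policy K) (ν : Model K) :
    (law π ν).map (fun ω => ω 0) = (π.first : Measure (Decision K)) ⊗ₘ rewardKernel ν := by
  have h : (fun ω : ℕ → Round K => ω 0)
      = (fun h : ((i : Finset.Iic 0) → Round K) => h ⟨0, by simp⟩) ∘ Preorder.frestrictLe 0 := rfl
  rw [h, ← Measure.map_map (by fun_prop) (by fun_prop), law, Kernel.trajMeasure,
    Measure.map_comp _ _ (by fun_prop), Kernel.traj_map_frestrictLe, Kernel.partialTraj_self,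
    Measure.id_comp, Measure.map_map (by fun_prop) (by fun_prop)]
  convert Measure.map_id
  funext x
  rfl

lemma map_frestrictLe_eval_law (π : Policy K) (ν : Model K) (n : ℕ) :
    (law π ν).map (fun ω => (Preorder.frestrictLe n ω, ω (n + 1)))
      = (law π ν).map (Preorder.frestrictLe n) ⊗ₘ stepKernel π ν n :=
  Kernel.map_frestrictLe_trajMeasure_compProd_eq_map_trajMeasure.symm

/-- Integration of a function of the rounds up to `s`, one round at a time. -/
lemma lintegral_law_step (π : Policy K) (ν : Model K) (y₀ : Round K) (s : ℕ)
    {F : (ℕ → Round K) → Round K → ℝ≥0∞} (hF : Measurable (Function.uncurry F)) :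
    ∫⁻ ω, F (past y₀ s ω) (ω s) ∂(law π ν)
      = ∫⁻ ω, ∫⁻ d, ∫⁻ x, F (past y₀ s ω) (d, x) ∂(rewardKernel ν d)
          ∂(decisionKernel π s (past y₀ s ω)) ∂(law π ν) := by
  cases s with
  | zero =>
    simp only [past_zero, decisionKernel, Kernel.const_apply, lintegral_const, measure_univ,
      mul_one]
    have hG : Measurable (F fun _ => y₀) := hF.of_uncurry_left
    rw [← lintegral_map (f := F fun _ => y₀) hG (measurable_pi_apply 0), map_eval_zero_law,
      Measure.lintegral_compProd hG]
  | succ n =>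
    -- Pads a finite history with `y₀`, so that functions of the past live on full runs and no
    -- dependent index on the length is needed.
    let E : ((i : Finset.Iic n) → Round K) → (ℕ → Round K) :=
      fun h i => if hi : i ≤ n then h ⟨i, Finset.mem_Iic.2 hi⟩ else y₀
    have hE : Measurable E := by
      refine measurable_pi_lambda _ fun i => ?_
      by_cases hi : i ≤ n
      · simpa [E, hi] using measurable_pi_apply _
      · simp [E, hi]
    have hEp : ∀ ω, past y₀ (n + 1) ω = E (Preorder.frestrictLe n ω) := by
      intro ω
      funext i
      by_cases hi : i ≤ n
      · simp [E, past, hi, Nat.lt_succ_of_le hi, Preorder.frestrictLe]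
      · simp [E, past, hi]
    have hG : Measurable (fun p : ((i : Finset.Iic n) → Round K) × Round K => F (E p.1) p.2) :=
      hF.comp ((hE.comp measurable_fst).prodMk measurable_snd)
    calc ∫⁻ ω, F (past y₀ (n + 1) ω) (ω (n + 1)) ∂(law π ν)
        = ∫⁻ p, F (E p.1) p.2 ∂((law π ν).map
            (fun ω => (Preorder.frestrictLe n ω, ω (n + 1)))) := by
          rw [lintegral_map hG (by fun_prop)]
          simp only [hEp]
      _ = ∫⁻ ω, ∫⁻ y, F (E (Preorder.frestrictLe n ω)) y
            ∂(stepKernel π ν n (Preorder.frestrictLe n ω)) ∂(law π ν) := by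
          rw [map_frestrictLe_eval_law, Measure.lintegral_compProd hG,
            lintegral_map hG.lintegral_kernel_prod_right' (by fun_prop)]
      _ = _ := by
          refine lintegral_congr fun ω => ?_
          rw [decisionKernel_past, hEp, stepKernel, Kernel.lintegral_compProd _ _ _
            (hF.of_uncurry_left)]
          rfl

/-! ### Runs that have not stopped yet. -/

/-- The learner does not stop before round `s`. -/
def Alive (s : ℕ) (ω : ℕ → Round K) : Prop := ∀ t < s, ¬ StopsAt ω t

/-- The learner stops in round `t` for the first time, and recommends `i`. -/
def RecommendsAt (i : Fin K) (t : ℕ) (ω : ℕ → Round K) : Prop :=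
  Alive t ω ∧ (ω t).1 = Decision.recommend i

lemma measurableSet_stopsAt (t : ℕ) : MeasurableSet {ω : ℕ → Round K | StopsAt ω t} := by
  have h : Measurable fun ω : ℕ → Round K => (ω t).1 := by fun_prop
  exact h (MeasurableSet.of_discrete (s := {d | ∃ i, d = Decision.recommend i}))

lemma measurableSet_alive (s : ℕ) : MeasurableSet {ω : ℕ → Round K | Alive s ω} := by
  have : {ω : ℕ → Round K | Alive s ω} = ⋂ t ∈ Finset.range s, {ω | StopsAt ω t}ᶜ := by
    ext ω; simp [Alive]
  rw [this]
  exact Finset.measurableSet_biInter _ fun t _ => (measurableSet_stopsAt t).compl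

lemma measurableSet_recommendsAt (i : Fin K) (t : ℕ) :
    MeasurableSet {ω : ℕ → Round K | RecommendsAt i t ω} := by
  have h : Measurable fun ω : ℕ → Round K => (ω t).1 := by fun_prop
  exact (measurableSet_alive t).inter
    (h (MeasurableSet.of_discrete (s := {Decision.recommend i})))

lemma alive_congr {s : ℕ} {ω ω' : ℕ → Round K} (h : ∀ t < s, ω t = ω' t) :
    Alive s ω ↔ Alive s ω' := by
  refine forall₂_congr fun t ht => ?_
  rw [StopsAt, StopsAt, h t ht]

lemma alive_succ {s : ℕ} {ω : ℕ → Round K} : Alive (s + 1) ω ↔ Alive s ω ∧ ¬ StopsAt ω s := by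
  simp only [Alive, Nat.forall_lt_succ_right]

lemma recommends_iff {ω : ℕ → Round K} {i : Fin K} :
    Recommends ω i ↔ ∃ t, RecommendsAt i t ω :=
  exists_congr fun _ => and_comm

lemma RecommendsAt.unique {ω : ℕ → Round K} {i j : Fin K} {t u : ℕ}
    (h : RecommendsAt i t ω) (h' : RecommendsAt j u ω) : t = u := by
  rcases lt_trichotomy t u with hlt | rfl | hlt
  · exact (h'.1 t hlt ⟨i, h.2⟩).elim
  · rfl
  · exact (h.1 u hlt ⟨j, h'.2⟩).elim

lemma alive_or_recommendsAt (n : ℕ) (ω : ℕ → Round K) :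
    Alive n ω ∨ ∃ t < n, ∃ i, RecommendsAt i t ω := by
  induction n with
  | zero => exact Or.inl fun t ht => (Nat.not_lt_zero t ht).elim
  | succ n ih =>
    rcases ih with h | ⟨t, ht, h⟩
    · by_cases hs : StopsAt ω n
      · obtain ⟨i, hi⟩ := hs
        exact Or.inr ⟨n, Nat.lt_succ_self n, i, h, hi⟩
      · exact Or.inl (alive_succ.2 ⟨h, hs⟩)
    · exact Or.inr ⟨t, Nat.lt_succ_of_lt ht, h⟩

lemma le_stoppingTime_of_alive {n : ℕ} {ω : ℕ → Round K} (h : Alive n ω) :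
    (n : ℕ∞) ≤ stoppingTime ω := by
  refine le_iInf₂ fun t ht => ?_
  by_contra! hlt
  exact h t (by exact_mod_cast hlt) ht

/-- Being alive at `s + 1` means that rounds `0, …, s` were all pulls, so the sum counts the pulls
among the first `n` rounds. -/
lemma sum_alive_le_stoppingTime (n : ℕ) (ω : ℕ → Round K) :
    ∑ s ∈ Finset.range n, {ω : ℕ → Round K | Alive (s + 1) ω}.indicator (1 : (ℕ → Round K) → ℝ≥0∞) ω
      ≤ (stoppingTime ω : ℝ≥0∞) := by
  classical
  have key : ∃ m : ℕ, (m : ℕ∞) ≤ stoppingTime ω ∧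
      ∑ s ∈ Finset.range n, {ω : ℕ → Round K | Alive (s + 1) ω}.indicator (1 : (ℕ → Round K) → ℝ≥0∞) ω
        ≤ m := by
    induction n with
    | zero => exact ⟨0, by simp, by simp⟩
    | succ n ih =>
      by_cases h : Alive (n + 1) ω
      · refine ⟨n + 1, le_stoppingTime_of_alive h, ?_⟩
        refine (Finset.sum_le_card_nsmul _ _ 1 fun s _ => ?_).trans (by simp)
        exact Set.indicator_le_self' (fun _ _ => zero_le) ω
      · obtain ⟨m, hm, hle⟩ := ih
        refine ⟨m, hm, ?_⟩
        rw [Finset.sum_range_succ]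
        simpa [Set.indicator, h] using hle
  obtain ⟨m, hm, hle⟩ := key
  refine hle.trans ?_
  have : ((m : ℕ∞) : ℝ≥0∞) ≤ (stoppingTime ω : ℝ≥0∞) := by exact_mod_cast hm
  simpa using this

/-! ### Change of measure between two models under a common policy. -/

section ChangeOfMeasure

variable {ν₁ ν₂ : Model K} {ℓ : Round K → ℝ}

/-- `ℓ` is the logarithm of the likelihood ratio of a round under `ν₂` and under `ν₁`, with mean at
least `-δ` under `ν₁`. -/
structure IsLogRatio (ν₁ ν₂ : Model K) (ℓ : Round K → ℝ) (δ : ℝ) : Prop where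
  measurable : Measurable ℓ
  lintegral_eq : ∀ d (f : ℝ → ℝ≥0∞), Measurable f →
    ∫⁻ x, f x ∂(rewardKernel ν₂ d)
      = ∫⁻ x, ENNReal.ofReal (Real.exp (ℓ (d, x))) * f x ∂(rewardKernel ν₁ d)
  integrable : ∀ d, Integrable (fun x => ℓ (d, x)) (rewardKernel ν₁ d)
  recommend : ∀ i x, ℓ (.recommend i, x) = 0
  le_integral : ∀ a, -δ ≤ ∫ x, ℓ (.pull a, x) ∂(rewardKernel ν₁ (.pull a))

variable {δ : ℝ}

/-- The policy's kernels are the same under both models, so only the rewards contribute to the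
likelihood ratio. -/
lemma IsLogRatio.lintegral_past (h : IsLogRatio ν₁ ν₂ ℓ δ) (π : Policy K) (y₀ : Round K) (s : ℕ)
    {F : (ℕ → Round K) → ℝ≥0∞} (hF : Measurable F) :
    ∫⁻ ω, F (past y₀ s ω) ∂(law π ν₂)
      = ∫⁻ ω, ENNReal.ofReal (Real.exp (∑ t ∈ Finset.range s, ℓ (past y₀ s ω t)))
          * F (past y₀ s ω) ∂(law π ν₁) := by
  have hℓ := h.measurable
  induction s generalizing F with
  | zero => simp [past_zero]
  | succ s ih =>
    have hup : Measurable fun p : (ℕ → Round K) × Round K => Function.update p.1 s p.2 := by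
      refine measurable_pi_lambda _ fun i => ?_
      by_cases hi : i = s
      · subst hi; simpa using measurable_snd
      · simpa [hi] using measurable_fst.eval
    have hF' : Measurable fun p : (ℕ → Round K) × Round K => F (Function.update p.1 s p.2) :=
      hF.comp hup
    have hexp : Measurable fun p : (ℕ → Round K) × Round K =>
        ENNReal.ofReal (Real.exp (∑ t ∈ Finset.range s, ℓ (p.1 t))) := by fun_prop
    have hexp' : Measurable fun p : (ℕ → Round K) × Round K =>
        ENNReal.ofReal (Real.exp (ℓ p.2)) := by fun_prop
    have hsum : ∀ (w : ℕ → Round K) (y : Round K),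
        ENNReal.ofReal (Real.exp (∑ t ∈ Finset.range (s + 1), ℓ (Function.update w s y t)))
          = ENNReal.ofReal (Real.exp (∑ t ∈ Finset.range s, ℓ (w t)))
            * ENNReal.ofReal (Real.exp (ℓ y)) := by
      intro w y
      rw [Finset.sum_range_succ, Real.exp_add, ENNReal.ofReal_mul (Real.exp_nonneg _)]
      rw [Function.update_self, Finset.sum_congr rfl fun t ht => by
        rw [Function.update_of_ne (Finset.mem_range.1 ht).ne]]
    have hG : Measurable fun w : ℕ → Round K => ∫⁻ d, ∫⁻ x, F (Function.update w s (d, x))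
        ∂(rewardKernel ν₂ d) ∂(decisionKernel π s w) := by
      have h1 : Measurable fun q : ((ℕ → Round K) × Decision K) × ℝ =>
          F (Function.update q.1.1 s (q.1.2, q.2)) :=
        hF'.comp ((measurable_fst.comp measurable_fst).prodMk
          ((measurable_snd.comp measurable_fst).prodMk measurable_snd))
      have h2 := h1.lintegral_kernel_prod_right'
        (κ := Kernel.prodMkLeft (ℕ → Round K) (rewardKernel ν₂))
      exact h2.lintegral_kernel_prod_right' (κ := decisionKernel π s)
    simp only [past_succ, hsum]
    -- Round `s` is integrated out under `ν₂`, the induction hypothesis changes the law of the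
    -- earlier rounds, and round `s` is then expressed under `ν₁`.
    rw [lintegral_law_step π ν₂ y₀ s (F := fun w y => F (Function.update w s y)) hF', ih hG,
      lintegral_law_step π ν₁ y₀ s (F := fun w y =>
        ENNReal.ofReal (Real.exp (∑ t ∈ Finset.range s, ℓ (w t)))
          * ENNReal.ofReal (Real.exp (ℓ y)) * F (Function.update w s y))
        ((hexp.mul hexp').mul hF')]
    refine lintegral_congr fun ω => ?_
    rw [← lintegral_const_mul _ (measurable_of_countable _)]
    refine lintegral_congr fun d => ?_
    have hm : Measurable fun x : ℝ => F (Function.update (past y₀ s ω) s (d, x)) :=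
      hF'.comp (measurable_const.prodMk (measurable_const.prodMk measurable_id))
    have hm' : Measurable fun x : ℝ => ENNReal.ofReal (Real.exp (ℓ (d, x))) := by fun_prop
    rw [h.lintegral_eq d _ hm, ← lintegral_const_mul _ (hm'.fun_mul hm)]
    simp only [mul_assoc]

/-- The log-likelihood ratio of the first `n` rounds, up to the first recommendation. -/
noncomputable def stoppedSum (ℓ : Round K → ℝ) (n : ℕ) (ω : ℕ → Round K) : ℝ :=
  ∑ t ∈ Finset.range n, {ω : ℕ → Round K | Alive t ω}.indicator (fun ω => ℓ (ω t)) ω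

lemma measurable_stoppedSum (hℓ : Measurable ℓ) (n : ℕ) : Measurable (stoppedSum ℓ n) := by
  refine Finset.measurable_fun_sum _ fun t _ => ?_
  exact Measurable.indicator (by fun_prop) (measurableSet_alive t)

lemma stoppedSum_congr {n : ℕ} {ω ω' : ℕ → Round K} (h : ∀ t < n, ω t = ω' t) :
    stoppedSum ℓ n ω = stoppedSum ℓ n ω' := by
  refine Finset.sum_congr rfl fun t ht => ?_
  have ht' := Finset.mem_range.1 ht
  have := alive_congr (s := t) (ω := ω) (ω' := ω') fun u hu => h u (hu.trans ht')
  by_cases ha : Alive t ω'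
  · simp [Set.indicator, this, ha, h t ht']
  · simp [Set.indicator, this, ha]

/-- Links the stopped sum to the fixed-horizon ratio of `IsLogRatio.lintegral_past`. Later rounds
must be cut off, since the policy may formally go on pulling after its recommendation. -/
lemma stoppedSum_eq_of_recommendsAt {i : Fin K} {t n : ℕ} (htn : t < n) {ω : ℕ → Round K}
    (h : RecommendsAt i t ω) : stoppedSum ℓ n ω = ∑ s ∈ Finset.range (t + 1), ℓ (ω s) := by
  have hsub : Finset.range (t + 1) ⊆ Finset.range n := by
    intro s hs
    simp only [Finset.mem_range] at *
    omega
  rw [stoppedSum, ← Finset.sum_subset hsub]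
  · refine Finset.sum_congr rfl fun s hs => ?_
    refine Set.indicator_of_mem (show Alive s ω from fun u hu => h.1 u ?_) _
    have := Finset.mem_range.1 hs
    omega
  · intro s _ hs
    refine Set.indicator_of_notMem (fun hal : Alive s ω => hal t ?_ ⟨i, h.2⟩) _
    rw [Finset.mem_range] at hs
    omega

lemma IsLogRatio.lintegral_exp (h : IsLogRatio ν₁ ν₂ ℓ δ) (d : Decision K) :
    ∫⁻ x, ENNReal.ofReal (Real.exp (ℓ (d, x))) ∂(rewardKernel ν₁ d) = 1 := by
  have := h.lintegral_eq d (fun _ => 1) measurable_const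
  simpa using this.symm

/-- The stopped likelihood ratio is a martingale: given the past, a further round multiplies it by a
factor of mean `1`, whatever the decision. -/
lemma IsLogRatio.lintegral_exp_stoppedSum (h : IsLogRatio ν₁ ν₂ ℓ δ) (π : Policy K)
    (y₀ : Round K) (n : ℕ) :
    ∫⁻ ω, ENNReal.ofReal (Real.exp (stoppedSum ℓ n ω)) ∂(law π ν₁) = 1 := by
  classical
  have hℓ := h.measurable
  induction n with
  | zero => simp [stoppedSum]
  | succ n ih =>
    have key : ∀ ω : ℕ → Round K, ENNReal.ofReal (Real.exp (stoppedSum ℓ (n + 1) ω))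
        = ENNReal.ofReal (Real.exp (stoppedSum ℓ n (past y₀ n ω)))
          * (if Alive n (past y₀ n ω) then ENNReal.ofReal (Real.exp (ℓ (ω n))) else 1) := by
      intro ω
      rw [alive_congr (ω := past y₀ n ω) (ω' := ω) fun t ht => past_apply ht ω,
        stoppedSum_congr (ω := past y₀ n ω) (ω' := ω) fun t ht => past_apply ht ω, stoppedSum,
        Finset.sum_range_succ, Real.exp_add, ENNReal.ofReal_mul (Real.exp_nonneg _), stoppedSum]
      by_cases ha : Alive n ω <;> simp [Set.indicator, ha]
    simp only [key]
    have hS := measurable_stoppedSum hℓ n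
    have hm : Measurable fun p : (ℕ → Round K) × Round K =>
        ENNReal.ofReal (Real.exp (stoppedSum ℓ n p.1))
          * (if Alive n p.1 then ENNReal.ofReal (Real.exp (ℓ p.2)) else 1) := by
      refine Measurable.mul (by fun_prop) (Measurable.ite ?_ (by fun_prop) measurable_const)
      exact measurable_fst (measurableSet_alive n)
    rw [lintegral_law_step π ν₁ y₀ n (F := fun w y =>
      ENNReal.ofReal (Real.exp (stoppedSum ℓ n w))
          * (if Alive n w then ENNReal.ofReal (Real.exp (ℓ y)) else 1)) hm]
    refine Eq.trans (lintegral_congr fun ω => ?_) ih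
    rw [stoppedSum_congr (ω := past y₀ n ω) (ω' := ω) fun t ht => past_apply ht ω]
    have : ∀ d, ∫⁻ x, ENNReal.ofReal (Real.exp (stoppedSum ℓ n ω))
        * (if Alive n (past y₀ n ω) then ENNReal.ofReal (Real.exp (ℓ (d, x))) else 1)
          ∂(rewardKernel ν₁ d) = ENNReal.ofReal (Real.exp (stoppedSum ℓ n ω)) := by
      intro d
      split_ifs
      · rw [lintegral_const_mul _ (by fun_prop), h.lintegral_exp, mul_one]
      · simp
    simp only [this, lintegral_const, measure_univ, mul_one]

/-- A function of the current round that is integrable and of nonnegative mean whatever the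
decision remains so when restricted to the runs that are still going on. -/
lemma integrable_indicator_alive_and_integral_nonneg (π : Policy K) (ν : Model K) (y₀ : Round K)
    (s : ℕ) {g : Round K → ℝ} (hg : Measurable g)
    (hint : ∀ d, Integrable (fun x => g (d, x)) (rewardKernel ν d))
    (hnn : ∀ d, 0 ≤ ∫ x, g (d, x) ∂(rewardKernel ν d)) :
    Integrable ({ω : ℕ → Round K | Alive s ω}.indicator fun ω => g (ω s)) (law π ν) ∧
      0 ≤ ∫ ω, {ω : ℕ → Round K | Alive s ω}.indicator (fun ω => g (ω s)) ω ∂(law π ν) := by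
  classical
  set A : Set (ℕ → Round K) := {ω | Alive s ω} with hA
  have hAm : MeasurableSet A := measurableSet_alive s
  have hmeas : Measurable (A.indicator fun ω : ℕ → Round K => g (ω s)) :=
    Measurable.indicator (by fun_prop) hAm
  have step : ∀ φ : ℝ → ℝ≥0∞, Measurable φ → φ 0 = 0 →
      ∫⁻ ω, φ (A.indicator (fun ω : ℕ → Round K => g (ω s)) ω) ∂(law π ν)
        = ∫⁻ ω, ∫⁻ d, A.indicator 1 (past y₀ s ω) * ∫⁻ x, φ (g (d, x)) ∂(rewardKernel ν d)
          ∂(decisionKernel π s (past y₀ s ω)) ∂(law π ν) := by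
    intro φ hφ hφ0
    have e : ∀ ω : ℕ → Round K, φ (A.indicator (fun ω : ℕ → Round K => g (ω s)) ω)
        = A.indicator 1 (past y₀ s ω) * φ (g (ω s)) := by
      intro ω
      have := alive_congr (ω := past y₀ s ω) (ω' := ω) fun t ht => past_apply ht ω
      by_cases ha : Alive s ω <;> simp [hA, Set.indicator, this, ha, hφ0]
    simp only [e]
    rw [lintegral_law_step π ν y₀ s (F := fun w y => A.indicator 1 w * φ (g y))]
    · refine lintegral_congr fun ω => lintegral_congr fun d => ?_
      rw [lintegral_const_mul _ (by fun_prop)]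
    · refine Measurable.mul ?_ (by fun_prop)
      exact (measurable_one.indicator hAm).comp measurable_fst
  have hI : Integrable (A.indicator fun ω : ℕ → Round K => g (ω s)) (law π ν) := by
    refine ⟨hmeas.aestronglyMeasurable, ?_⟩
    have := Fintype.ofFinite (Decision K)
    -- As there are finitely many decisions, the sum of their absolute moments bounds every
    -- conditional moment.
    set C : ℝ≥0∞ := ∑ d : Decision K, ∫⁻ x, ‖g (d, x)‖ₑ ∂(rewardKernel ν d) with hC
    have hCt : C < ∞ := ENNReal.sum_lt_top.2 fun d _ => (hint d).2
    rw [hasFiniteIntegral_def, step (fun r => ‖r‖ₑ) (by fun_prop) (by simp)]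
    refine lt_of_le_of_lt ?_ hCt
    calc _ ≤ ∫⁻ ω, ∫⁻ d, C ∂(decisionKernel π s (past y₀ s ω)) ∂(law π ν) := by
          refine lintegral_mono fun ω => lintegral_mono fun d => ?_
          calc _ ≤ 1 * ∫⁻ x, ‖g (d, x)‖ₑ ∂(rewardKernel ν d) := by
                gcongr
                exact Set.indicator_le_self' (fun _ _ => zero_le) _
            _ ≤ C := by
                rw [one_mul]
                exact Finset.single_le_sum (f := fun d => ∫⁻ x, ‖g (d, x)‖ₑ ∂(rewardKernel ν d))
                  (fun _ _ => zero_le) (Finset.mem_univ d)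
      _ = C := by simp
  refine ⟨hI, ?_⟩
  -- The disintegration is available for nonnegative functions, so positive and negative parts are
  -- compared separately, decision by decision.
  rw [integral_eq_lintegral_pos_part_sub_lintegral_neg_part hI, sub_nonneg]
  refine ENNReal.toReal_mono hI.lintegral_lt_top.ne ?_
  rw [step (fun r => ENNReal.ofReal r) (by fun_prop) (by simp),
    step (fun r => ENNReal.ofReal (-r)) (by fun_prop) (by simp)]
  refine lintegral_mono fun ω => lintegral_mono fun d => ?_
  have hd := hnn d
  rw [integral_eq_lintegral_pos_part_sub_lintegral_neg_part (hint d), sub_nonneg] at hd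
  exact mul_le_mul_right ((ENNReal.toReal_le_toReal (hint d).neg.lintegral_lt_top.ne
    (hint d).lintegral_lt_top.ne).1 hd) _

/-- A Wald-type inequality: each pull made before stopping lowers the mean of the log-likelihood
ratio by at most `δ`. -/
lemma IsLogRatio.integrable_stoppedSum_and_le_integral (h : IsLogRatio ν₁ ν₂ ℓ δ) (π : Policy K)
    (y₀ : Round K) (n : ℕ) :
    Integrable (stoppedSum ℓ n) (law π ν₁) ∧
      -(δ * ∑ s ∈ Finset.range n, (law π ν₁).real {ω | Alive (s + 1) ω})
        ≤ ∫ ω, stoppedSum ℓ n ω ∂(law π ν₁) := by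
  classical
  have hℓ := h.measurable
  -- Compensator: `ℓ + P` has nonnegative conditional mean for every decision, and a recommendation
  -- contributes nothing to either term.
  let P : Round K → ℝ := fun y => if ∃ a, y.1 = Decision.pull a then δ else 0
  have hP : Measurable P := by
    refine Measurable.ite ?_ measurable_const measurable_const
    exact measurable_fst (MeasurableSet.of_discrete (s := {d | ∃ a, d = Decision.pull a}))
  have hterm : ∀ s, Integrable ({ω : ℕ → Round K | Alive s ω}.indicator fun ω => ℓ (ω s))
      (law π ν₁) ∧ -(δ * (law π ν₁).real {ω | Alive (s + 1) ω})
        ≤ ∫ ω, {ω : ℕ → Round K | Alive s ω}.indicator (fun ω => ℓ (ω s)) ω ∂(law π ν₁) := by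
    intro s
    have hPint : ∀ d, Integrable (fun x : ℝ => P (d, x)) (rewardKernel ν₁ d) :=
      fun d => integrable_const (if ∃ a, d = Decision.pull a then δ else 0)
    obtain ⟨hi, hn⟩ := integrable_indicator_alive_and_integral_nonneg π ν₁ y₀ s
      (g := fun y => ℓ y + P y) (hℓ.add hP) (fun d => (h.integrable d).add (hPint d)) (by
        intro d
        rw [integral_add (h.integrable d) (hPint d)]
        cases d with
        | pull a =>
          have := h.le_integral a
          have hPa : ∫ x, P (.pull a, x) ∂(rewardKernel ν₁ (.pull a)) = δ := by simp [P]
          linarith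
        | recommend i => simp [P, h.recommend])
    have hPeq : ∀ ω : ℕ → Round K, {ω : ℕ → Round K | Alive (s + 1) ω}.indicator (fun _ => δ) ω
        = {ω : ℕ → Round K | Alive s ω}.indicator (fun ω => P (ω s)) ω := by
      intro ω
      by_cases ha : Alive s ω
      · rcases hd : (ω s).1 with a | i
        · simp [Set.indicator, alive_succ, ha, P, StopsAt, hd]
        · simp [Set.indicator, alive_succ, P, StopsAt, hd]
      · simp [Set.indicator, alive_succ, ha]
    have hδ : Integrable ({ω : ℕ → Round K | Alive (s + 1) ω}.indicator fun _ => δ)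
        (law π ν₁) := (integrable_const δ).indicator (measurableSet_alive _)
    have hsub : ({ω : ℕ → Round K | Alive s ω}.indicator fun ω => ℓ (ω s))
        = fun ω => {ω : ℕ → Round K | Alive s ω}.indicator (fun ω => ℓ (ω s) + P (ω s)) ω
          - {ω : ℕ → Round K | Alive (s + 1) ω}.indicator (fun _ => δ) ω := by
      funext ω
      rw [hPeq]
      by_cases ha : Alive s ω <;> simp [Set.indicator, ha]
    rw [hsub]
    refine ⟨hi.sub hδ, ?_⟩
    rw [integral_sub hi hδ, integral_indicator_const _ (measurableSet_alive _), smul_eq_mul]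
    linarith
  refine ⟨integrable_finsetSum _ fun s _ => (hterm s).1, ?_⟩
  unfold stoppedSum
  rw [integral_finsetSum _ fun s _ => (hterm s).1, Finset.mul_sum, ← Finset.sum_neg_distrib]
  exact Finset.sum_le_sum fun s _ => (hterm s).2

/-- The total variation part of the two-point method. -/
lemma IsLogRatio.lintegral_min_le (h : IsLogRatio ν₁ ν₂ ℓ δ) (π : Policy K) (y₀ : Round K)
    {b : Fin K} (hb₁ : ∀ i, i ≠ b → ¬ IsBest ν₁ i) (hb₂ : ¬ IsBest ν₂ b) (n : ℕ) :
    ∫⁻ ω, ENNReal.ofReal (min 1 (Real.exp (stoppedSum ℓ n ω))) ∂(law π ν₁)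
      ≤ law π ν₁ {ω | ∃ i, Recommends ω i ∧ ¬ IsBest ν₁ i} + law π ν₁ {ω | Alive n ω}
        + law π ν₂ {ω | ∃ i, Recommends ω i ∧ ¬ IsBest ν₂ i} := by
  classical
  have hℓ := h.measurable
  have hmeas : ∀ ν : Model K,
      MeasurableSet {ω : ℕ → Round K | ∃ i, Recommends ω i ∧ ¬ IsBest ν i} := by
    intro ν
    have : {ω : ℕ → Round K | ∃ i, Recommends ω i ∧ ¬ IsBest ν i}
        = ⋃ (i : Fin K) (_ : ¬ IsBest ν i) (t : ℕ), {ω | RecommendsAt i t ω} := by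
      ext ω
      simp only [Set.mem_ofPred_eq, recommends_iff, Set.mem_iUnion, exists_prop]
      exact exists_congr fun _ => and_comm
    rw [this]
    exact MeasurableSet.iUnion fun i => MeasurableSet.iUnion fun _ =>
      MeasurableSet.iUnion fun t => measurableSet_recommendsAt i t
  set E₁ := {ω : ℕ → Round K | ∃ i, Recommends ω i ∧ ¬ IsBest ν₁ i} with hE₁
  -- Recommending `b` at round `t` is decided by the first `t + 1` rounds, so weighting it by their
  -- likelihood ratio turns its `ν₁`-mass into its `ν₂`-probability.
  let R : ℕ → (ℕ → Round K) → ℝ≥0∞ := fun t ω =>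
    ENNReal.ofReal (Real.exp (∑ s ∈ Finset.range (t + 1), ℓ (ω s)))
      * {ω : ℕ → Round K | RecommendsAt b t ω}.indicator 1 ω
  have hR : ∀ t, Measurable (R t) := fun t =>
    Measurable.mul (by fun_prop) (measurable_one.indicator (measurableSet_recommendsAt b t))
  have hRint : ∀ t, ∫⁻ ω, R t ω ∂(law π ν₁) = law π ν₂ {ω | RecommendsAt b t ω} := by
    intro t
    have hrec : ∀ ω : ℕ → Round K, RecommendsAt b t (past y₀ (t + 1) ω) ↔ RecommendsAt b t ω := by
      intro ω
      rw [RecommendsAt, RecommendsAt, past_apply (Nat.lt_succ_self t),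
        alive_congr fun u hu => past_apply (hu.trans (Nat.lt_succ_self t)) ω]
    have := h.lintegral_past π y₀ (t + 1)
      (measurable_one.indicator (measurableSet_recommendsAt b t))
    have e1 : ∀ ω : ℕ → Round K, {ω : ℕ → Round K | RecommendsAt b t ω}.indicator
        (1 : (ℕ → Round K) → ℝ≥0∞) (past y₀ (t + 1) ω)
          = {ω : ℕ → Round K | RecommendsAt b t ω}.indicator 1 ω := by
      intro ω
      by_cases hr : RecommendsAt b t ω <;> simp [Set.indicator, hrec, hr]
    have e2 : ∀ ω : ℕ → Round K, ∑ s ∈ Finset.range (t + 1), ℓ (past y₀ (t + 1) ω s)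
        = ∑ s ∈ Finset.range (t + 1), ℓ (ω s) := fun ω =>
      Finset.sum_congr rfl fun s hs => by rw [past_apply (Finset.mem_range.1 hs)]
    simp only [e1, e2] at this
    rw [lintegral_indicator_one (measurableSet_recommendsAt b t)] at this
    exact this.symm
  -- The bound `1` is used on runs that are still alive or err under `ν₁`; the bound `exp S` on runs
  -- recommending `b`, which err under `ν₂`.
  have hpt : ∀ ω : ℕ → Round K, ENNReal.ofReal (min 1 (Real.exp (stoppedSum ℓ n ω)))
      ≤ E₁.indicator 1 ω + {ω : ℕ → Round K | Alive n ω}.indicator 1 ω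
        + ∑ t ∈ Finset.range n, R t ω := by
    intro ω
    have hle : ENNReal.ofReal (min 1 (Real.exp (stoppedSum ℓ n ω))) ≤ 1 := by
      rw [← ENNReal.ofReal_one]
      exact ENNReal.ofReal_le_ofReal (min_le_left _ _)
    rcases alive_or_recommendsAt n ω with ha | ⟨t, ht, i, hi⟩
    · refine le_add_right (le_add_left ?_)
      simp [Set.indicator, ha]
    · by_cases hib : i = b
      · subst hib
        refine le_add_left ?_
        refine le_trans ?_ (Finset.single_le_sum (f := fun t => R t ω) (fun _ _ => zero_le)
          (Finset.mem_range.2 ht))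
        rw [stoppedSum_eq_of_recommendsAt ht hi]
        simp only [R, Set.indicator, Set.mem_ofPred_eq, hi, if_true, Pi.one_apply, mul_one]
        exact ENNReal.ofReal_le_ofReal (min_le_right _ _)
      · refine le_add_right (le_add_right ?_)
        have : ω ∈ E₁ := ⟨i, recommends_iff.2 ⟨t, hi⟩, hb₁ i hib⟩
        simp [Set.indicator, this]
  refine (lintegral_mono hpt).trans ?_
  have hm1 : Measurable (E₁.indicator (1 : (ℕ → Round K) → ℝ≥0∞)) :=
    measurable_one.indicator (hmeas ν₁)
  have hm2 : Measurable ({ω : ℕ → Round K | Alive n ω}.indicator (1 : (ℕ → Round K) → ℝ≥0∞)) :=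
    measurable_one.indicator (measurableSet_alive n)
  rw [lintegral_add_left (hm1.fun_add hm2), lintegral_add_left hm1,
    lintegral_indicator_one (hmeas ν₁), lintegral_indicator_one (measurableSet_alive n),
    lintegral_finsetSum _ fun t _ => hR t]
  gcongr
  simp only [hRint]
  rw [← measure_biUnion_finset _ fun t _ => measurableSet_recommendsAt b t]
  · refine measure_mono ?_
    intro ω hω
    simp only [Set.mem_iUnion, Set.mem_ofPred_eq, exists_prop] at hω
    obtain ⟨t, _, ht⟩ := hω
    exact ⟨b, recommends_iff.2 ⟨t, ht⟩, hb₂⟩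
  · intro t _ u _ htu
    exact Set.disjoint_left.2 fun ω h1 h2 => htu (RecommendsAt.unique h1 h2)

end ChangeOfMeasure

/-! ### From the likelihood ratio to a lower bound on the two risks. -/

/-- A linearized form of the Bretagnolle–Huber inequality. -/
lemma exp_neg_mul_sub_le_min (κ S : ℝ) :
    Real.exp (-κ) * (1 + (S + κ) / 2) - Real.exp (-κ) / 4 * (1 + Real.exp S)
      ≤ min 1 (Real.exp S) := by
  set r := Real.exp (-κ / 2) with hr
  set y := Real.exp (S / 2) with hy
  have hq : Real.exp (-κ) = r ^ 2 := by rw [hr, ← Real.exp_nat_mul]; congr 1; push_cast; ring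
  have hS : Real.exp S = y ^ 2 := by rw [hy, ← Real.exp_nat_mul]; congr 1; push_cast; ring
  -- The tangent bound `1 + x ≤ exp x` stands in for Jensen's inequality; `κ` fixes the point of
  -- tangency `S = -κ`.
  have h1 : r * (1 + (S + κ) / 2) ≤ y := by
    have : y = r * Real.exp ((S + κ) / 2) := by rw [hr, hy, ← Real.exp_add]; congr 1; ring
    rw [this]
    gcongr
    linarith [Real.add_one_le_exp ((S + κ) / 2)]
  have hr0 : 0 < r := Real.exp_pos _
  have h2 : r ^ 2 * (1 + (S + κ) / 2) ≤ r * y := by nlinarith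
  -- With the left side at most `r * y - r ^ 2 * (1 + y ^ 2) / 4`, the gaps to `1` and `y ^ 2` are
  -- at least `(1 - r * y / 2) ^ 2 + r ^ 2 / 4` and `(y - r / 2) ^ 2 + r ^ 2 * y ^ 2 / 4`.
  rw [hq, hS, le_min_iff]
  constructor
  · nlinarith [sq_nonneg (1 - r * y / 2), sq_nonneg r]
  · nlinarith [sq_nonneg (y - r / 2), sq_nonneg (r * y)]

/-- Markov's inequality: a run alive at `n` has taken at least `n` samples. -/
lemma tendsto_law_alive (π : Policy K) (ν : Model K)
    (hT : ∫⁻ ω, (stoppingTime ω : ℝ≥0∞) ∂(law π ν) ≠ ∞) :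
    Filter.Tendsto (fun n => law π ν {ω | Alive n ω}) Filter.atTop (nhds 0) := by
  set T := ∫⁻ ω, (stoppingTime ω : ℝ≥0∞) ∂(law π ν)
  have hlim : Filter.Tendsto (fun n : ℕ => T / (n : ℝ≥0∞)) Filter.atTop (nhds 0) := by
    simpa using ENNReal.Tendsto.const_div (a := T) ENNReal.tendsto_nat_nhds_top (Or.inr hT)
  refine tendsto_of_tendsto_of_tendsto_of_le_of_le' tendsto_const_nhds hlim
    (Filter.Eventually.of_forall fun _ => zero_le) ?_
  filter_upwards [Filter.eventually_ge_atTop 1] with n hn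
  refine (ENNReal.le_div_iff_mul_le (Or.inl (Nat.cast_ne_zero.2 (by omega)))
    (Or.inl (ENNReal.natCast_ne_top n))).2 ?_
  rw [mul_comm, ← lintegral_indicator_const (measurableSet_alive n)]
  refine lintegral_mono fun ω => ?_
  by_cases ha : Alive n ω
  · have : ((n : ℕ∞) : ℝ≥0∞) ≤ (stoppingTime ω : ℝ≥0∞) := by
      exact_mod_cast le_stoppingTime_of_alive ha
    simpa [Set.indicator, ha] using this
  · simp [Set.indicator, ha]

/-- Integrates `exp_neg_mul_sub_le_min` at `S = stoppedSum ℓ n`: the exponential moment is exactly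
`1`, and the mean of `S` is at least `-δ` times the expected number of samples. -/
lemma IsLogRatio.le_integral_min {ν₁ ν₂ : Model K} {ℓ : Round K → ℝ} {δ : ℝ}
    (h : IsLogRatio ν₁ ν₂ ℓ δ) (π : Policy K) (y₀ : Round K) (κ : ℝ) (hδ : 0 ≤ δ)
    (hT : ∫⁻ ω, (stoppingTime ω : ℝ≥0∞) ∂(law π ν₁) ≠ ∞) (n : ℕ) :
    Real.exp (-κ) / 2 * (1 + κ - δ * (∫⁻ ω, (stoppingTime ω : ℝ≥0∞) ∂(law π ν₁)).toReal)
      ≤ ∫ ω, min 1 (Real.exp (stoppedSum ℓ n ω)) ∂(law π ν₁) := by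
  obtain ⟨hint, hle⟩ := h.integrable_stoppedSum_and_le_integral π y₀ n
  have hS := measurable_stoppedSum h.measurable n
  have hexp := h.lintegral_exp_stoppedSum π y₀ n
  have hexpi : Integrable (fun ω => Real.exp (stoppedSum ℓ n ω)) (law π ν₁) := by
    refine ⟨(by fun_prop), ?_⟩
    rw [hasFiniteIntegral_iff_ofReal (Filter.Eventually.of_forall fun _ => Real.exp_nonneg _),
      hexp]
    exact ENNReal.one_lt_top
  have hexpv : ∫ ω, Real.exp (stoppedSum ℓ n ω) ∂(law π ν₁) = 1 := by
    rw [integral_eq_lintegral_of_nonneg_ae (Filter.Eventually.of_forall fun _ => Real.exp_nonneg _)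
      hexpi.1, hexp, ENNReal.toReal_one]
  have hsum : ∑ s ∈ Finset.range n, (law π ν₁).real {ω | Alive (s + 1) ω}
      ≤ (∫⁻ ω, (stoppingTime ω : ℝ≥0∞) ∂(law π ν₁)).toReal := by
    simp only [Measure.real]
    rw [← ENNReal.toReal_sum fun _ _ => measure_ne_top _ _]
    refine ENNReal.toReal_mono hT ?_
    simp only [← lintegral_indicator_one (measurableSet_alive _)]
    rw [← lintegral_finsetSum _ fun s _ => measurable_one.indicator (measurableSet_alive (s + 1))]
    exact lintegral_mono fun ω => sum_alive_le_stoppingTime n ω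
  have hmono : ∫ ω, (Real.exp (-κ) * (1 + (stoppedSum ℓ n ω + κ) / 2)
      - Real.exp (-κ) / 4 * (1 + Real.exp (stoppedSum ℓ n ω))) ∂(law π ν₁)
      ≤ ∫ ω, min 1 (Real.exp (stoppedSum ℓ n ω)) ∂(law π ν₁) := by
    refine integral_mono ?_ ?_ fun ω => exp_neg_mul_sub_le_min κ _
    · exact (((integrable_const 1).add ((hint.add (integrable_const κ)).div_const 2)).const_mul
        _).sub (((integrable_const 1).add hexpi).const_mul _)
    · exact (integrable_const 1).inf hexpi
  refine le_trans ?_ hmono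
  rw [integral_sub, integral_const_mul, integral_const_mul, integral_add, integral_add,
    integral_div, integral_add, hexpv]
  · simp only [integral_const, probReal_univ, smul_eq_mul, one_mul]
    have := Real.exp_pos (-κ)
    have h3 := mul_le_mul_of_nonneg_left hsum hδ
    have : Real.exp (-κ) / 2 * (-(δ * (∫⁻ ω, (stoppingTime ω : ℝ≥0∞) ∂(law π ν₁)).toReal))
        ≤ Real.exp (-κ) / 2 * ∫ ω, stoppedSum ℓ n ω ∂(law π ν₁) := by
      gcongr
      linarith
    linarith
  · exact hint
  · exact integrable_const κ
  · exact integrable_const 1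
  · exact hexpi
  · exact integrable_const 1
  · exact (hint.add (integrable_const κ)).div_const 2
  · exact ((integrable_const 1).add ((hint.add (integrable_const κ)).div_const 2)).const_mul _
  · exact ((integrable_const 1).add hexpi).const_mul _

/-- The two-point method: no policy has small risk under both models. -/
lemma IsLogRatio.le_risk_add_risk {ν₁ ν₂ : Model K} {ℓ : Round K → ℝ} {δ : ℝ}
    (h : IsLogRatio ν₁ ν₂ ℓ δ) (π : Policy K) {b : Fin K} (hb₁ : ∀ i, i ≠ b → ¬ IsBest ν₁ i)
    (hb₂ : ¬ IsBest ν₂ b) (hδ : 0 ≤ δ) {c κ : ℝ} (hc : 0 < c)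
    (hκ : Real.exp (-κ) * δ / 2 ≤ c) :
    ENNReal.ofReal (Real.exp (-κ) * (1 + κ) / 2) ≤ risk₁ c π ν₁ + risk₁ c π ν₂ := by
  let y₀ : Round K := (.pull b, 0)
  set T := ∫⁻ ω, (stoppingTime ω : ℝ≥0∞) ∂(law π ν₁) with hTdef
  by_cases hT : T = ∞
  -- With infinite expected sampling under `ν₁`, the cost alone makes the risk infinite.
  · have : risk₁ c π ν₁ = ∞ := by
      rw [risk₁, ← hTdef, hT, ENNReal.mul_top (ENNReal.ofReal_pos.2 hc).ne', add_top]
    simp [this]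
  set p₁ := law π ν₁ {ω | ∃ i, Recommends ω i ∧ ¬ IsBest ν₁ i} with hp₁
  set p₂ := law π ν₂ {ω | ∃ i, Recommends ω i ∧ ¬ IsBest ν₂ i} with hp₂
  have hn : ∀ n, ENNReal.ofReal (Real.exp (-κ) / 2 * (1 + κ - δ * T.toReal))
      ≤ p₁ + law π ν₁ {ω | Alive n ω} + p₂ := by
    intro n
    refine le_trans ?_ (h.lintegral_min_le π y₀ hb₁ hb₂ n)
    have hS := measurable_stoppedSum h.measurable n
    rw [← ofReal_integral_eq_lintegral_ofReal]
    · exact ENNReal.ofReal_le_ofReal (h.le_integral_min π y₀ κ hδ hT n)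
    · refine Integrable.of_bound (by fun_prop) 1 (Filter.Eventually.of_forall fun ω => ?_)
      rw [Real.norm_of_nonneg (le_min zero_le_one (Real.exp_nonneg _))]
      exact min_le_left _ _
    · exact Filter.Eventually.of_forall fun ω => le_min zero_le_one (Real.exp_nonneg _)
  have hlim : ENNReal.ofReal (Real.exp (-κ) / 2 * (1 + κ - δ * T.toReal)) ≤ p₁ + p₂ := by
    have := ((tendsto_law_alive π ν₁ hT).const_add p₁).add_const p₂
    rw [add_zero] at this
    exact ge_of_tendsto' this hn
  calc ENNReal.ofReal (Real.exp (-κ) * (1 + κ) / 2)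
      ≤ ENNReal.ofReal (Real.exp (-κ) / 2 * (1 + κ - δ * T.toReal) + c * T.toReal) := by
        refine ENNReal.ofReal_le_ofReal ?_
        -- By `hκ`, the sampling cost under `ν₁` outweighs the information term `exp (-κ) / 2 * δ *
        -- T`. The cost under `ν₂` is discarded below.
        have := mul_le_mul_of_nonneg_right hκ (ENNReal.toReal_nonneg (a := T))
        linarith
    _ ≤ ENNReal.ofReal (Real.exp (-κ) / 2 * (1 + κ - δ * T.toReal))
          + ENNReal.ofReal (c * T.toReal) := ENNReal.ofReal_add_le
    _ ≤ p₁ + p₂ + ENNReal.ofReal c * T := by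
        rw [ENNReal.ofReal_mul hc.le, ENNReal.ofReal_toReal hT]
        gcongr
    _ = risk₁ c π ν₁ + p₂ := by rw [risk₁, add_right_comm]
    _ ≤ risk₁ c π ν₁ + risk₁ c π ν₂ := by
        gcongr
        exact le_self_add

/-! ### The pair of Gaussian models. -/

section Gaussian

open scoped NNReal

/-- The model with Gaussian rewards of means `m` and common variance `v`. -/
noncomputable def gaussianModel (m : Fin K → ℝ) (v : ℝ≥0) : Model K :=
  fun a => ⟨gaussianReal (m a) v, inferInstance⟩

lemma mean_gaussianModel (m : Fin K → ℝ) (v : ℝ≥0) (a : Fin K) :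
    mean (gaussianModel m v) a = m a := integral_id_gaussianReal

lemma integrable_id_gaussianReal (μ : ℝ) (v : ℝ≥0) :
    Integrable (fun x : ℝ => x) (gaussianReal μ v) :=
  (memLp_id_gaussianReal 1).integrable le_rfl

/-- Chernoff's bound for the centred Gaussian. -/
lemma isSubGaussian_gaussianReal {σ : ℝ} {v : ℝ≥0} (hv : (v : ℝ) = σ ^ 2) (μ : ℝ) :
    IsSubGaussian σ ⟨gaussianReal μ v, inferInstance⟩ := by
  refine ⟨integrable_id_gaussianReal μ v, fun t ht => ?_⟩
  have hX : (gaussianReal μ v).map (fun x => x - μ) = gaussianReal 0 v := by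
    rw [gaussianReal_map_sub_const, sub_self]
  have hG : HasSubgaussianMGF (fun x => x - μ) v (gaussianReal μ v) := by
    refine ⟨fun s => ?_, fun s => ?_⟩
    · have := integrable_exp_mul_gaussianReal (μ := 0) (v := v) s
      rw [← hX] at this
      exact this.comp_measurable (by fun_prop)
    · rw [mgf_gaussianReal hX]
      simp
  have h1 := hG.measure_ge_le ht.le
  have hm : ∫ y, y ∂(gaussianReal μ v) = μ := integral_id_gaussianReal
  simp only [ProbabilityMeasure.coe_mk, hm]
  have hsub : {x | t < x - μ} ⊆ {x | t ≤ x - μ} :=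
    Set.ofPred_subset_ofPred.2 fun _ => le_of_lt
  refine (measure_mono hsub).trans ?_
  rw [← ENNReal.ofReal_toReal (measure_ne_top (gaussianReal μ v) {x | t ≤ x - μ})]
  refine ENNReal.ofReal_le_ofReal (h1.trans (le_of_eq ?_))
  rw [hv, neg_div]

/-- The log-likelihood ratio of two Gaussian models. -/
noncomputable def gaussianLogRatio (m₁ m₂ : Fin K → ℝ) (v : ℝ≥0) (y : Round K) : ℝ :=
  match y.1 with
  | .pull a => (m₂ a - m₁ a) / v * y.2 - (m₂ a ^ 2 - m₁ a ^ 2) / (2 * v)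
  | .recommend _ => 0

lemma gaussianPDF_eq_exp_mul {v : ℝ≥0} (hv : v ≠ 0) (μ₁ μ₂ x : ℝ) :
    gaussianPDF μ₂ v x = gaussianPDF μ₁ v x
      * ENNReal.ofReal (Real.exp ((μ₂ - μ₁) / v * x - (μ₂ ^ 2 - μ₁ ^ 2) / (2 * v))) := by
  have hv' : (v : ℝ) ≠ 0 := by exact_mod_cast hv
  rw [gaussianPDF, gaussianPDF, ← ENNReal.ofReal_mul (gaussianPDFReal_nonneg _ _ _),
    gaussianPDFReal, gaussianPDFReal, mul_assoc (√(2 * Real.pi * v))⁻¹, ← Real.exp_add]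
  congr 3
  field_simp
  ring

/-- The constant is the relative entropy of two Gaussians of variance `v` whose means differ by `Δ`.
-/
lemma isLogRatio_gaussianLogRatio {v : ℝ≥0} (hv : v ≠ 0) (m₁ m₂ : Fin K → ℝ) {Δ : ℝ}
    (hΔ : ∀ a, (m₂ a - m₁ a) ^ 2 ≤ Δ ^ 2) :
    IsLogRatio (gaussianModel m₁ v) (gaussianModel m₂ v) (gaussianLogRatio m₁ m₂ v)
      (Δ ^ 2 / (2 * v)) where
  measurable := by
    refine measurable_from_prod_countable_right fun d => ?_
    cases d <;> (simp only [gaussianLogRatio]; fun_prop)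
  lintegral_eq d f hf := by
    cases d with
    | recommend i =>
      change ∫⁻ x, f x ∂(Measure.dirac 0) = ∫⁻ x, _ ∂(Measure.dirac 0)
      simp [gaussianLogRatio]
    | pull a =>
      change ∫⁻ x, f x ∂(gaussianReal (m₂ a) v) = ∫⁻ x, _ ∂(gaussianReal (m₁ a) v)
      rw [gaussianReal_of_var_ne_zero _ hv, gaussianReal_of_var_ne_zero _ hv,
        lintegral_withDensity_eq_lintegral_mul _ (measurable_gaussianPDF _ _) hf,
        lintegral_withDensity_eq_lintegral_mul _ (measurable_gaussianPDF _ _)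
          (by simp only [gaussianLogRatio]; fun_prop)]
      refine lintegral_congr fun x => ?_
      simp only [Pi.mul_apply, gaussianLogRatio]
      rw [gaussianPDF_eq_exp_mul hv (m₁ a) (m₂ a), mul_assoc]
  integrable d := by
    cases d with
    | recommend i => exact integrable_zero _ _ _
    | pull a =>
      exact ((integrable_id_gaussianReal (m₁ a) v).const_mul _).sub (integrable_const _)
  recommend _ _ := rfl
  le_integral a := by
    change _ ≤ ∫ x, ((m₂ a - m₁ a) / v * x - (m₂ a ^ 2 - m₁ a ^ 2) / (2 * v))
      ∂(gaussianReal (m₁ a) v)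
    have hv' : (0 : ℝ) < v := by exact_mod_cast pos_iff_ne_zero.2 hv
    rw [integral_sub ((integrable_id_gaussianReal (m₁ a) v).const_mul _) (integrable_const _),
      integral_const_mul, integral_id_gaussianReal]
    simp only [integral_const, probReal_univ, smul_eq_mul, one_mul]
    have e : (m₂ a - m₁ a) / v * m₁ a - (m₂ a ^ 2 - m₁ a ^ 2) / (2 * v)
        = -((m₂ a - m₁ a) ^ 2 / (2 * v)) := by
      field_simp
      ring
    rw [e, neg_le_neg_iff]
    exact div_le_div_of_nonneg_right (hΔ a) (by positivity)

/-- Means with best arm `b`, second best arm `j` at distance `Δ`, and all other arms at `0`. -/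
def twoArmMeans (B Δ : ℝ) (b j k : Fin K) : ℝ :=
  if k = b then B else if k = j then B - Δ else 0

lemma isBest_twoArmMeans_iff {B Δ : ℝ} (hB : 0 < B) (hΔ : 0 < Δ) (b j i : Fin K) (v : ℝ≥0) :
    IsBest (gaussianModel (twoArmMeans B Δ b j) v) i ↔ i = b := by
  simp only [IsBest, mean_gaussianModel]
  constructor
  · intro h
    by_contra hi
    have := h b
    simp only [twoArmMeans, if_true, hi, if_false] at this
    split_ifs at this <;> linarith
  · rintro rfl a
    simp only [twoArmMeans, if_true]
    split_ifs <;> linarith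

lemma gaussianModel_twoArmMeans_mem {σ B Δ H : ℝ} {v : ℝ≥0} (hv : (v : ℝ) = σ ^ 2) (hB : 0 < B)
    (hΔ : 0 < Δ) (hΔB : Δ ≤ B) {b j : Fin K} (hbj : b ≠ j)
    (hH : (Δ⁻¹) ^ 2 + ((K : ℝ) - 2) * (B⁻¹) ^ 2 ≤ H) :
    gaussianModel (twoArmMeans B Δ b j) v ∈ modelsOfComplexity K σ B H := by
  refine ⟨fun a => ⟨isSubGaussian_gaussianReal hv _, ?_⟩, ?_⟩
  · rw [mean_gaussianModel, twoArmMeans]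
    split_ifs <;> constructor <;> linarith
  · refine iInf₂_le_of_le b ((isBest_twoArmMeans_iff hB hΔ b j b v).2 rfl) ?_
    simp only [mean_gaussianModel]
    have hj : j ∈ Finset.univ.erase b := Finset.mem_erase.2 ⟨hbj.symm, Finset.mem_univ _⟩
    have hcard : (((Finset.univ.erase b).erase j).card : ℝ) = (K : ℝ) - 2 := by
      have h1 := Finset.card_erase_add_one hj
      have h2 := Finset.card_erase_add_one (Finset.mem_univ b)
      rw [Finset.card_univ, Fintype.card_fin] at h2
      have : ((Finset.univ.erase b).erase j).card + 2 = K := by omega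
      have h3 : (((Finset.univ.erase b).erase j).card : ℝ) + 2 = K := by exact_mod_cast this
      linarith
    rw [← Finset.add_sum_erase _ _ hj]
    have e1 : twoArmMeans B Δ b j b - twoArmMeans B Δ b j j = Δ := by
      simp [twoArmMeans, hbj.symm]
    have e2 : ∀ k ∈ (Finset.univ.erase b).erase j,
        ((ENNReal.ofReal (twoArmMeans B Δ b j b - twoArmMeans B Δ b j k))⁻¹) ^ 2
          = ENNReal.ofReal ((B⁻¹) ^ 2) := by
      intro k hk
      simp only [Finset.mem_erase, Finset.mem_univ, and_true] at hk
      have : twoArmMeans B Δ b j b - twoArmMeans B Δ b j k = B := by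
        simp [twoArmMeans, hk.1, hk.2]
      rw [this, ← ENNReal.ofReal_inv_of_pos hB, ENNReal.ofReal_pow (by positivity)]
    rw [Finset.sum_congr rfl e2, Finset.sum_const, e1, ← ENNReal.ofReal_inv_of_pos hΔ,
      ← ENNReal.ofReal_pow (by positivity), ← ENNReal.ofReal_nsmul,
      ← ENNReal.ofReal_add (by positivity) (by positivity), nsmul_eq_mul, hcard]
    exact ENNReal.ofReal_le_ofReal hH

end Gaussian

/-! ### Choice of the parameters and conclusion. -/

/-- The choice of the tilting parameter that balances the two parts of the risk. -/
lemma exists_exp_neg_mul_ge {u : ℝ} (hu : 0 < u) :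
    ∃ κ : ℝ, Real.exp (-κ) ≤ 3 * u ∧
      (if u ≤ 1 then u / 4 * Real.log (Real.exp 1 / u) else 1 / 4)
        ≤ Real.exp (-κ) * (1 + κ) / 4 := by
  have hlog : Real.log (Real.exp 1 / u) = 1 - Real.log u := by
    rw [Real.log_div (Real.exp_pos 1).ne' hu.ne', Real.log_exp]
  rw [hlog]
  by_cases h : 3 * u ≤ 1
  -- The constraint is made an equality. As `log u ≤ -log 3`, the second claim reduces to `log 3 ≤
  -- 2`.
  · refine ⟨-Real.log (3 * u), ?_, ?_⟩
    · rw [neg_neg, Real.exp_log (by positivity)]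
    · rw [neg_neg, Real.exp_log (by positivity), if_pos (by linarith),
        Real.log_mul (by norm_num) hu.ne']
      have h1 : Real.log 3 + Real.log u ≤ 0 := by
        rw [← Real.log_mul (by norm_num) hu.ne']
        exact Real.log_nonpos (by positivity) h
      have h2 : Real.log 3 ≤ 2 := by linarith [Real.log_le_sub_one_of_pos (x := 3) (by norm_num)]
      nlinarith
  -- Here `κ = 0` is admissible and gives `1 / 4`, which suffices for `u ≤ 1` because `u * (1 - log
  -- u) ≤ 1`.
  · refine ⟨0, by simp; linarith, ?_⟩
    simp only [neg_zero, Real.exp_zero, add_zero, one_mul]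
    split_ifs with hu1
    · have h1 := Real.log_le_sub_one_of_pos (x := u⁻¹) (by positivity)
      rw [Real.log_inv] at h1
      have h2 : u * (1 - Real.log u) ≤ u * u⁻¹ := by gcongr; linarith
      rw [mul_inv_cancel₀ hu.ne'] at h2
      linarith
    · exact le_rfl

lemma exists_gap {K : ℕ} (hK : 2 ≤ K) {B H : ℝ} (hB : 0 < B) (hH : 0 < H)
    (hHB : 4 * ((K : ℝ) - 1) ≤ H * B ^ 2 ∨ (K = 2 ∧ 1 ≤ H * B ^ 2)) :
    ∃ Δ : ℝ, 0 < Δ ∧ Δ ≤ B ∧ (Δ⁻¹) ^ 2 + ((K : ℝ) - 2) * (B⁻¹) ^ 2 ≤ H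
      ∧ 3 * H / 4 ≤ (Δ⁻¹) ^ 2 := by
  have hK' : (2 : ℝ) ≤ K := by exact_mod_cast hK
  -- `G = Δ⁻²` is the share of the complexity budget spent on the second best arm.
  have main : ∀ G : ℝ, 0 < G → 1 ≤ G * B ^ 2 → G + ((K : ℝ) - 2) * (B⁻¹) ^ 2 ≤ H →
      3 * H / 4 ≤ G → ∃ Δ : ℝ, 0 < Δ ∧ Δ ≤ B ∧ (Δ⁻¹) ^ 2 + ((K : ℝ) - 2) * (B⁻¹) ^ 2 ≤ H
      ∧ 3 * H / 4 ≤ (Δ⁻¹) ^ 2 := by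
    intro G hG h1 h2 h3
    have e : (((√G)⁻¹)⁻¹) ^ 2 = G := by rw [inv_inv, Real.sq_sqrt hG.le]
    refine ⟨(√G)⁻¹, by positivity, ?_, by rwa [e], by rwa [e]⟩
    have hs : 0 < √G := Real.sqrt_pos.2 hG
    rw [inv_le_iff_one_le_mul₀ hs]
    have : (1 : ℝ) ^ 2 ≤ (B * √G) ^ 2 := by
      rw [mul_pow, Real.sq_sqrt hG.le]; linarith
    exact le_of_sq_le_sq this (by positivity)
  rcases hHB with h | ⟨rfl, h⟩
  -- The remaining `H / 4` pays for the `K - 2` arms at distance `B`. With two arms there are none,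
  -- and the whole budget goes to the gap.
  · refine main (3 * H / 4) (by positivity) (by linarith) ?_ le_rfl
    have h4 : ((K : ℝ) - 2) * (B⁻¹) ^ 2 ≤ H / 4 := by
      rw [inv_pow, ← div_eq_mul_inv, div_le_iff₀ (by positivity)]
      linarith
    linarith
  · exact main H hH h (by norm_num) (by linarith)

/-- The worst-case risk over a complexity class is bounded below by its hardness. -/
theorem hardness₁_le_iSup_risk₁ {K : ℕ} (hK : 2 ≤ K) {σ B H c : ℝ} (hσ : 0 < σ) (hB : 0 < B) (hH : 0 < H)
    (hc : 0 < c)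
    (hHB : 4 * ((K : ℝ) - 1) ≤ H * B ^ 2 ∨ (K = 2 ∧ 1 ≤ H * B ^ 2))
    (π : Policy K) :
    ENNReal.ofReal (hardness₁ σ c H)
      ≤ ⨆ ν ∈ modelsOfComplexity K σ B H, risk₁ c π ν := by
  obtain ⟨Δ, hΔ, hΔB, hcomp, hgap⟩ := exists_gap hK hB hH hHB
  obtain ⟨κ, hκ, hκ'⟩ := exists_exp_neg_mul_ge (u := σ ^ 2 * c * H) (by positivity)
  let v : NNReal := ⟨σ ^ 2, sq_nonneg σ⟩
  have hv : (v : ℝ) = σ ^ 2 := rfl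
  have hv0 : v ≠ 0 := by
    rw [← NNReal.coe_ne_zero, hv]
    positivity
  let b : Fin K := ⟨0, by omega⟩
  let j : Fin K := ⟨1, by omega⟩
  have hbj : b ≠ j := by simp [b, j]
  set ν₁ := gaussianModel (twoArmMeans B Δ b j) v
  set ν₂ := gaussianModel (twoArmMeans B Δ j b) v
  have hL : IsLogRatio ν₁ ν₂
      (gaussianLogRatio (twoArmMeans B Δ b j) (twoArmMeans B Δ j b) v) (Δ ^ 2 / (2 * v)) := by
    refine isLogRatio_gaussianLogRatio hv0 _ _ fun a => ?_
    by_cases hab : a = b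
    · simp [twoArmMeans, hab, hbj]
    · by_cases haj : a = j
      · simp [twoArmMeans, haj, hbj.symm]
      · simp [twoArmMeans, hab, haj, sq_nonneg]
  have hsum := hL.le_risk_add_risk π (b := b) (c := c) (κ := κ)
    (fun i hi => fun h => hi ((isBest_twoArmMeans_iff hB hΔ b j i v).1 h))
    (fun h => hbj ((isBest_twoArmMeans_iff hB hΔ j b b v).1 h)) (by positivity) hc (by
      -- This `4 / 3` cancels the factor `3` in the bound on `exp (-κ)`, leaving exactly `c`.
      have h1 : H * Δ ^ 2 ≤ 4 / 3 := by
        have : (3 * H / 4) * Δ ^ 2 ≤ (Δ⁻¹) ^ 2 * Δ ^ 2 := by gcongr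
        rw [← mul_pow, inv_mul_cancel₀ hΔ.ne', one_pow] at this
        linarith
      calc Real.exp (-κ) * (Δ ^ 2 / (2 * v)) / 2
          ≤ 3 * (σ ^ 2 * c * H) * (Δ ^ 2 / (2 * v)) / 2 := by gcongr
        _ = 3 / 4 * c * (H * Δ ^ 2) := by rw [hv]; field_simp; ring
        _ ≤ 3 / 4 * c * (4 / 3) := by gcongr
        _ = c := by ring)
  have h₁ : risk₁ c π ν₁ ≤ ⨆ ν ∈ modelsOfComplexity K σ B H, risk₁ c π ν :=
    le_iSup₂_of_le ν₁ (gaussianModel_twoArmMeans_mem hv hB hΔ hΔB hbj hcomp) le_rfl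
  have h₂ : risk₁ c π ν₂ ≤ ⨆ ν ∈ modelsOfComplexity K σ B H, risk₁ c π ν :=
    le_iSup₂_of_le ν₂ (gaussianModel_twoArmMeans_mem hv hB hΔ hΔB hbj.symm hcomp) le_rfl
  have hhard : hardness₁ σ c H ≤ Real.exp (-κ) * (1 + κ) / 4 := by
    refine le_of_eq_of_le ?_ hκ'
    have : H ≤ (σ ^ 2 * c)⁻¹ ↔ σ ^ 2 * c * H ≤ 1 := by
      rw [le_inv_comm₀ hH (by positivity), ← one_div, le_div_iff₀ hH]
    simp only [hardness₁, this]
  set M := ⨆ ν ∈ modelsOfComplexity K σ B H, risk₁ c π ν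
  have h2 : 2 * ENNReal.ofReal (hardness₁ σ c H) ≤ 2 * M := by
    calc 2 * ENNReal.ofReal (hardness₁ σ c H)
        ≤ 2 * ENNReal.ofReal (Real.exp (-κ) * (1 + κ) / 4) := by gcongr
      _ = ENNReal.ofReal (Real.exp (-κ) * (1 + κ) / 2) := by
          rw [← ENNReal.ofReal_ofNat 2, ← ENNReal.ofReal_mul (by norm_num)]
          congr 1
          ring
      _ ≤ M + M := hsum.trans (add_le_add h₁ h₂)
      _ = 2 * M := (two_mul M).symm
  exact (ENNReal.mul_le_mul_iff_right (by norm_num) (by norm_num)).1 h2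

end BAI

theorem theorem1 (K : ℕ) (hK : 2 ≤ K) (σ B H c : ℝ) (hσ : 0 < σ) (hB : 0 < B) (hH : 0 < H)
    (hc : 0 < c)
    (hHB : 4 * ((K : ℝ) - 1) ≤ H * B ^ 2 ∨ (K = 2 ∧ 1 ≤ H * B ^ 2))
    (π : BAI.Policy K) :
    ENNReal.ofReal (BAI.hardness₁ σ c H)
      ≤ ⨆ ν ∈ BAI.modelsOfComplexity K σ B H, BAI.risk₁ c π ν := by
  exact BAI.hardness₁_le_iSup_risk₁ hK hσ hB hH hc hHB π
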